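/- Let $d\ge 2$ and let $\Lambda\subset\mathbb R^d$ be a unimodular lattice (full rank, covolume $1$), with dual lattice $\Lambda^*=\{y\in\mathbb R^d:\langle y,x\rangle\in\mathbb Z\text{ for all }x\in\Lambda\}$. Let $\mathcal T=\{\tau\in\mathbb R^d:\tau_1+\dots+\tau_d=0\}$, and let $|\cdot|$ be the sup-norm. For $\tau\in\mathcal T$ put $\mathcal B_\tau=\operatorname{diag}(e^{\tau_1},\dots,e^{\tau_d})\,[-1,1]^d$. For $1\le k\le d$ let $\lambda_k(\mathcal B_\tau,\Lambda)$ be the $k$-th successive minimum, i.e. the infimum of the $\lambda>0$ such that $\lambda\mathcal B_\tau$ contains at least $k$ linearly independent vectors of $\Lambda$, and let $L_k(\tau,\Lambda)=\log\lambda_k(\mathcal B_\tau,\Lambda)$. Let $f:\mathcal T\to[0,\infty)$ be any function whose sublevel sets $\{\tau\in\mathcal T: f(\tau)\le r\}$, $r\in\mathbb R$, are all bounded (so that they form a monotone exhaustion of $\mathcal T$ by bounded sets), and let $f^*(\tau)=f(-\tau)$. Put $$\psi_k(\tau,\Lambda,f)=\frac{L_k(\tau,\Lambda)}{f(\tau)},\qquad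 \Psi_k(\tau,\Lambda,f)=\sum_{j=1}^k\psi_j(\tau,\Lambda,f)$$ (defined whenever $f(\tau)>0$, hence for all $\tau$ with $|\tau|$ large), and define the Schmidt–Summerer exponents, as elements of $[-\infty,+\infty]$, by $$\underline\psi_k(\Lambda,f)=\liminf_{|\tau|\to\infty}\psi_k,\quad \overline\psi_k(\Lambda,f)=\limsup_{|\tau|\to\infty}\psi_k,\quad \underline\Psi_k(\Lambda,f)=\liminf_{|\tau|\to\infty}\Psi_k,\quad \overline\Psi_k(\Lambda,f)=\limsup_{|\tau|\to\infty}\Psi_k .$$ Then, where the arguments $(\Lambda,f)$ are understood if omitted and $0\cdot(-\infty)=0$, the following hold. 1. $\underline\psi_k\le\underline\psi_{k+1}$ and $\overline\psi_k\le\overline\psi_{k+1}$ for $1\le k\le d-1$. 2. $\underline\Psi_1=\underline\psi_1\le0$ and $\overline\Psi_1=\overline\psi_1\le0$. 3. $\underline\Psi_{d-1}=-\overline\psi_d$ and $\overline\Psi_{d-1}=-\underline\psi_d$. 4. $\underline\Psi_d=\overline\Psi_d=0$. 5. For $1\le k\le d-1$: $\frac{k+1}{k}\underline\Psi_k\le\underline\Psi_{k+1}\le\frac{d-k-1}{d-k}\underline\Psi_k\le0$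 and $\frac{k+1}{k}\overline\Psi_k\le\overline\Psi_{k+1}\le\frac{d-k-1}{d-k}\overline\Psi_k\le0$. 6. $(d-1)\underline\Psi_1\le\underline\Psi_{d-1}\le\frac{\underline\Psi_1}{d-1}$ and $(d-1)\overline\Psi_1\le\overline\Psi_{d-1}\le\frac{\overline\Psi_1}{d-1}$. 7. For $1\le k\le d$: $\underline\psi_k(\Lambda,f)=-\overline\psi_{d+1-k}(\Lambda^*,f^*)$ and $\overline\psi_k(\Lambda,f)=-\underline\psi_{d+1-k}(\Lambda^*,f^*)$. 8. For $1\le k\le d-1$: $\underline\Psi_k(\Lambda,f)=\underline\Psi_{d-k}(\Lambda^*,f^*)$ and $\overline\Psi_k(\Lambda,f)=\overline\Psi_{d-k}(\Lambda^*,f^*)$. -/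

import Mathlib

open Filter

noncomputable section

namespace LatticeExponents

/-- The hyperplane `𝒯` of vectors `τ ∈ ℝ^d` with `τ₁ + ⋯ + τ_d = 0`, with the norm induced by the
sup-norm of `Fin d → ℝ`. -/
def traceZero (d : ℕ) : Submodule ℝ (Fin d → ℝ) where
  carrier := {τ | ∑ i, τ i = 0}
  add_mem' := by
    intro a b ha hb
    simp only [Set.mem_ofPred_eq, Pi.add_apply, Finset.sum_add_distrib] at *
    rw [ha, hb, add_zero]
  zero_mem' := by simp
  smul_mem' := by
    intro c a ha
    simp only [Set.mem_ofPred_eq, Pi.smul_apply, smul_eq_mul, ← Finset.mul_sum] at *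
    rw [ha, mul_zero]

/-- The parallelepiped `B_τ = D_τ B`, where `D_τ = diag(e^{τ₁}, …, e^{τ_d})` and `B` is the closed
unit ball of the sup-norm. -/
def box {d : ℕ} (τ : Fin d → ℝ) : Set (Fin d → ℝ) :=
  (fun x => (Matrix.diagonal fun i => Real.exp (τ i)).mulVec x) '' Metric.closedBall 0 1

/-- The `k`-th successive minimum of `B` with respect to `Λ`: the infimum of the positive `r` such
that `r B` contains at least `k` linearly independent vectors of `Λ`. -/
def successiveMinimum {d : ℕ} (k : ℕ) (B : Set (Fin d → ℝ)) (Λ : Submodule ℤ (Fin d → ℝ)) : ℝ :=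
  sInf {r : ℝ | 0 < r ∧ ∃ v : Fin k → (Fin d → ℝ), LinearIndependent ℝ v ∧
    ∀ i, v i ∈ Λ ∧ ∃ x ∈ B, v i = r • x}

/-- `L_k(τ, Λ) = log λ_k(B_τ, Λ)`. -/
def logMinimum {d : ℕ} (k : ℕ) (τ : traceZero d) (Λ : Submodule ℤ (Fin d → ℝ)) : ℝ :=
  Real.log (successiveMinimum k (box (τ : Fin d → ℝ)) Λ)

/-- The dual lattice: all `y` with `⟨y, x⟩ ∈ ℤ` for every `x ∈ Λ`. -/
def dualLattice {d : ℕ} (Λ : Submodule ℤ (Fin d → ℝ)) : Submodule ℤ (Fin d → ℝ) where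
  carrier := {y | ∀ x ∈ Λ, ∃ n : ℤ, y ⬝ᵥ x = (n : ℝ)}
  add_mem' := by
    intro a b ha hb x hx
    obtain ⟨m, hm⟩ := ha x hx
    obtain ⟨n, hn⟩ := hb x hx
    exact ⟨m + n, by rw [add_dotProduct, hm, hn]; push_cast; ring⟩
  zero_mem' := fun x _ => ⟨0, by simp⟩
  smul_mem' := by
    intro c a ha x hx
    obtain ⟨m, hm⟩ := ha x hx
    exact ⟨c * m, by rw [smul_dotProduct, hm]; simp⟩

/-- `f` is non-negative and its sublevel sets `{τ ∈ 𝒯 | f τ ≤ r}` exhaust `𝒯` by bounded sets.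
(These sets automatically increase with `r` and cover `𝒯`.) -/
structure IsExhausting {d : ℕ} (f : traceZero d → ℝ) : Prop where
  nonneg : ∀ τ, 0 ≤ f τ
  isBounded_sublevel : ∀ r : ℝ, Bornology.IsBounded {τ : traceZero d | f τ ≤ r}

/-- `f^*(τ) = f(-τ)`. -/
def reflect {d : ℕ} (f : traceZero d → ℝ) : traceZero d → ℝ := fun τ => f (-τ)

/-- `ψ_k(τ, Λ, f) = L_k(τ, Λ) / f(τ)`. -/
def psi {d : ℕ} (k : ℕ) (τ : traceZero d) (Λ : Submodule ℤ (Fin d → ℝ)) (f : traceZero d → ℝ) : ℝ :=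
  logMinimum k τ Λ / f τ

/-- `Ψ_k(τ, Λ, f) = ∑_{1 ≤ j ≤ k} ψ_j(τ, Λ, f)`. -/
def bigPsi {d : ℕ} (k : ℕ) (τ : traceZero d) (Λ : Submodule ℤ (Fin d → ℝ))
    (f : traceZero d → ℝ) : ℝ :=
  ∑ j ∈ Finset.Icc 1 k, psi j τ Λ f

/-- Schmidt–Summerer lower exponent of the first type: `liminf` of `ψ_k` as `|τ| → ∞`. -/
def lowerExp₁ {d : ℕ} (k : ℕ) (Λ : Submodule ℤ (Fin d → ℝ)) (f : traceZero d → ℝ) : EReal :=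
  liminf (fun τ => (psi k τ Λ f : EReal)) (Bornology.cobounded (traceZero d))

/-- Schmidt–Summerer upper exponent of the first type: `limsup` of `ψ_k` as `|τ| → ∞`. -/
def upperExp₁ {d : ℕ} (k : ℕ) (Λ : Submodule ℤ (Fin d → ℝ)) (f : traceZero d → ℝ) : EReal :=
  limsup (fun τ => (psi k τ Λ f : EReal)) (Bornology.cobounded (traceZero d))

/-- Schmidt–Summerer lower exponent of the second type: `liminf` of `Ψ_k` as `|τ| → ∞`. -/
def lowerExp₂ {d : ℕ} (k : ℕ) (Λ : Submodule ℤ (Fin d → ℝ)) (f : traceZero d → ℝ) : EReal :=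
  liminf (fun τ => (bigPsi k τ Λ f : EReal)) (Bornology.cobounded (traceZero d))

/-- Schmidt–Summerer upper exponent of the second type: `limsup` of `Ψ_k` as `|τ| → ∞`. -/
def upperExp₂ {d : ℕ} (k : ℕ) (Λ : Submodule ℤ (Fin d → ℝ)) (f : traceZero d → ℝ) : EReal :=
  limsup (fun τ => (bigPsi k τ Λ f : EReal)) (Bornology.cobounded (traceZero d))

end LatticeExponents

end

/-! Write L_k and L*_k for the log-minima of Λ at τ and of Λ* at -τ. Everything follows from three
facts valid uniformly in τ: L_1 ≤ ... ≤ L_d, the sum L_1 + ... + L_d is O(1), and L_k + L*_{d+1-k} =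
O(1). Since f tends to infinity along the cobounded filter, bounded errors vanish after division by
f. Each claim thus reduces to a linear inequality between partial sums of the L_k, and the duality
claims also use the substitution τ ↦ -τ.

The two bounded sums are Minkowski's second theorem and Mahler's duality, but only half of each
needs a direct proof. Minkowski's convex body theorem bounds the product of the minima from above
(`IsMinimalFamily.prod_scaledNorm_le`), for Λ and for Λ*. Integrality of the pairing gives L_k +
L*_{d+1-k} ≥ -log d (`neg_log_le_logMinimum_add`). Summing the latter over k and comparing with the
former yields both missing halves (`exists_bound_logMinimum`). -/

noncomputable section

namespace LatticeExponents

variable {d : ℕ}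

/-! ### The gauge of the box and finiteness of lattice points -/

/-- The gauge of `box τ`: the sup-norm of `D_{-τ} x`. -/
def scaledNorm (τ : Fin d → ℝ) (x : Fin d → ℝ) : ℝ := ‖fun i => Real.exp (-τ i) * x i‖

lemma scaledNorm_nonneg (τ x : Fin d → ℝ) : 0 ≤ scaledNorm τ x := norm_nonneg _

lemma scaledNorm_le_iff {τ x : Fin d → ℝ} {r : ℝ} (hr : 0 ≤ r) :
    scaledNorm τ x ≤ r ↔ ∀ i, |x i| ≤ Real.exp (τ i) * r := by
  rw [scaledNorm, pi_norm_le_iff_of_nonneg hr]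
  refine forall_congr' fun i => ?_
  rw [Real.norm_eq_abs, abs_mul, abs_of_pos (Real.exp_pos _), Real.exp_neg,
    inv_mul_le_iff₀ (Real.exp_pos _)]

lemma abs_apply_le (τ x : Fin d → ℝ) (i : Fin d) :
    |x i| ≤ Real.exp (τ i) * scaledNorm τ x :=
  (scaledNorm_le_iff (scaledNorm_nonneg τ x)).1 le_rfl i

lemma scaledNorm_pos {τ x : Fin d → ℝ} (hx : x ≠ 0) : 0 < scaledNorm τ x := by
  refine (scaledNorm_nonneg τ x).lt_of_ne fun h => hx ?_
  ext i
  have := abs_apply_le τ x i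
  rw [← h, mul_zero] at this
  simpa using this

lemma exists_mem_box_smul_iff {τ v : Fin d → ℝ} {r : ℝ} (hr : 0 < r) :
    (∃ x ∈ box τ, v = r • x) ↔ scaledNorm τ v ≤ r := by
  constructor
  · rintro ⟨_, ⟨y, hy, rfl⟩, rfl⟩
    rw [scaledNorm_le_iff hr.le]
    intro i
    have : |y i| ≤ 1 := (norm_le_pi_norm y i).trans (by simpa using hy)
    simp only [Pi.smul_apply, Matrix.mulVec_diagonal, smul_eq_mul, abs_mul, abs_of_pos hr,
      abs_of_pos (Real.exp_pos (τ i))]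
    nlinarith [mul_pos hr (Real.exp_pos (τ i))]
  · intro h
    refine ⟨r⁻¹ • v, ⟨r⁻¹ • fun i => Real.exp (-τ i) * v i, ?_, ?_⟩, by
      rw [smul_smul, mul_inv_cancel₀ hr.ne', one_smul]⟩
    · rw [mem_closedBall_zero_iff, norm_smul, norm_inv, Real.norm_of_nonneg hr.le,
        inv_mul_le_iff₀ hr, mul_one]
      exact h
    · ext i
      simp only [Matrix.mulVec_diagonal, Pi.smul_apply, smul_eq_mul]
      rw [mul_left_comm, ← mul_assoc (Real.exp _), ← Real.exp_add]
      simp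

lemma finite_scaledNorm_le (τ : Fin d → ℝ) (Λ : Submodule ℤ (Fin d → ℝ)) [DiscreteTopology Λ]
    (R : ℝ) : {x : Fin d → ℝ | x ∈ Λ ∧ scaledNorm τ x ≤ R}.Finite := by
  have hdisc : DiscreteTopology Λ.toAddSubgroup := ‹DiscreteTopology Λ›
  have hcl : IsClosed (Λ.toAddSubgroup : Set (Fin d → ℝ)) :=
    AddSubgroup.isClosed_of_discrete
  have hb : Bornology.IsBounded {x : Fin d → ℝ | scaledNorm τ x ≤ R} := by
    rw [isBounded_iff_forall_norm_le]
    refine ⟨(∑ i, Real.exp (τ i)) * |R|, fun x hx => ?_⟩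
    have h0 : 0 ≤ ∑ i, Real.exp (τ i) := Finset.sum_nonneg fun i _ => (Real.exp_pos _).le
    rw [pi_norm_le_iff_of_nonneg (by positivity)]
    intro i
    refine (abs_apply_le τ x i).trans ?_
    have h1 : Real.exp (τ i) ≤ ∑ i, Real.exp (τ i) :=
      Finset.single_le_sum (f := fun i => Real.exp (τ i)) (fun i _ => (Real.exp_pos _).le)
        (Finset.mem_univ i)
    exact mul_le_mul h1 (le_trans hx (le_abs_self R)) (scaledNorm_nonneg _ _) h0
  refine (Metric.finite_isBounded_inter_isClosed (s := (Λ : Set (Fin d → ℝ)))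
    (isDiscrete_iff_discreteTopology.2 ‹_›) hb hcl).subset ?_
  rintro x ⟨h1, h2⟩
  exact ⟨h2, h1⟩

lemma exists_scaledNorm_min (τ : Fin d → ℝ) (Λ : Submodule ℤ (Fin d → ℝ)) [DiscreteTopology Λ]
    (P : (Fin d → ℝ) → Prop) (hP : ∃ x ∈ Λ, P x) :
    ∃ x ∈ Λ, P x ∧ ∀ y ∈ Λ, P y → scaledNorm τ x ≤ scaledNorm τ y := by
  obtain ⟨x₀, hx₀, hp₀⟩ := hP
  have hfin : {x : Fin d → ℝ | (x ∈ Λ ∧ scaledNorm τ x ≤ scaledNorm τ x₀) ∧ P x}.Finite :=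
    (finite_scaledNorm_le τ Λ (scaledNorm τ x₀)).subset fun x hx => hx.1
  obtain ⟨x, ⟨⟨hx, hx'⟩, hp⟩, hmin⟩ :=
    Set.exists_min_image _ (scaledNorm τ) hfin ⟨x₀, ⟨hx₀, le_rfl⟩, hp₀⟩
  refine ⟨x, hx, hp, fun y hy hpy => ?_⟩
  rcases le_total (scaledNorm τ y) (scaledNorm τ x₀) with h | h
  · exact hmin y ⟨⟨hy, h⟩, hpy⟩
  · exact hx'.trans h

/-! ### Vectors realizing the successive minima -/

/-- A family of lattice vectors each of which has minimal `scaledNorm` among the lattice vectors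
outside the span of its predecessors. -/
structure IsMinimalFamily (τ : Fin d → ℝ) (Λ : Submodule ℤ (Fin d → ℝ)) {k : ℕ}
    (v : Fin k → Fin d → ℝ) : Prop where
  linearIndependent : LinearIndependent ℝ v
  mem : ∀ i, v i ∈ Λ
  le_of_notMem : ∀ i, ∀ x ∈ Λ, x ∉ Submodule.span ℝ (v '' Set.Iio i) →
    scaledNorm τ (v i) ≤ scaledNorm τ x

/-- Greedy choice: fewer than d vectors cannot span, whereas Λ spans, so some lattice vector lies
outside their span, and by discreteness one of least gauge exists. -/
lemma exists_isMinimalFamily_of_le (τ : Fin d → ℝ) (Λ : Submodule ℤ (Fin d → ℝ))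
    [DiscreteTopology Λ] [IsZLattice ℝ Λ] :
    ∀ k ≤ d, ∃ v : Fin k → Fin d → ℝ, IsMinimalFamily τ Λ v := by
  intro k
  induction k with
  | zero => exact fun _ => ⟨Fin.elim0, linearIndependent_empty_type, fun i => i.elim0,
      fun i => i.elim0⟩
  | succ k ih =>
    intro hk
    obtain ⟨v, hv⟩ := ih (by omega)
    have hne : ∃ x ∈ Λ, x ∉ Submodule.span ℝ (Set.range v) := by
      by_contra! hcon
      have h1 : (⊤ : Submodule ℝ (Fin d → ℝ)) ≤ Submodule.span ℝ (Set.range v) := by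
        rw [← IsZLattice.span_top (K := ℝ) (L := Λ), Submodule.span_le]
        exact hcon
      have h2 := finrank_range_le_card (R := ℝ) v
      rw [Set.finrank, top_le_iff.1 h1] at h2
      simp at h2
      omega
    obtain ⟨x, hx, hxs, hmin⟩ := exists_scaledNorm_min τ Λ _ hne
    have him : ∀ i : Fin k, (Fin.snoc v x : Fin (k + 1) → Fin d → ℝ) '' Set.Iio i.castSucc
        = v '' Set.Iio i := by
      intro i
      rw [← Fin.image_castSucc_Iio, Set.image_image]
      simp
    have hlast : (Fin.snoc v x : Fin (k + 1) → Fin d → ℝ) '' Set.Iio (Fin.last k)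
        = Set.range v := by
      have : Set.Iio (Fin.last k) = Set.range Fin.castSucc := by
        ext j
        simp [Fin.range_castSucc, Fin.lt_def]
      rw [this, ← Set.range_comp]
      congr 1
      ext1 i
      simp
    refine ⟨Fin.snoc v x, linearIndependent_finSnoc.2 ⟨hv.linearIndependent, hxs⟩, ?_, ?_⟩
    · refine Fin.lastCases (by simpa using hx) fun i => by simpa using hv.mem i
    · refine Fin.lastCases ?_ fun i => ?_
      · intro y hy hys
        rw [hlast] at hys
        simpa using hmin y hy hys
      · intro y hy hys
        rw [him] at hys
        simpa using hv.le_of_notMem i y hy hys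

lemma exists_isMinimalFamily (τ : Fin d → ℝ) (Λ : Submodule ℤ (Fin d → ℝ))
    [DiscreteTopology Λ] [IsZLattice ℝ Λ] :
    ∃ v : Fin d → Fin d → ℝ, IsMinimalFamily τ Λ v :=
  exists_isMinimalFamily_of_le τ Λ d le_rfl

namespace IsMinimalFamily

variable {τ : Fin d → ℝ} {Λ : Submodule ℤ (Fin d → ℝ)} {k : ℕ} {v : Fin k → Fin d → ℝ}

lemma scaledNorm_pos (hv : IsMinimalFamily τ Λ v) (i : Fin k) : 0 < scaledNorm τ (v i) :=
  LatticeExponents.scaledNorm_pos (hv.linearIndependent.ne_zero i)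

lemma monotone (hv : IsMinimalFamily τ Λ v) : Monotone fun i => scaledNorm τ (v i) := by
  intro i j hij
  refine hv.le_of_notMem i (v j) (hv.mem j) ?_
  refine hv.linearIndependent.notMem_span_image ?_
  simpa using hij

/-- Among any i + 1 independent lattice vectors, one escapes the span of the i vectors preceding `v
i`, so its gauge is at least that of `v i`. The shift is between `Fin` indices from 0 and minima
numbered from 1. -/
lemma successiveMinimum_eq (hv : IsMinimalFamily τ Λ v) (i : Fin k) :
    successiveMinimum (i + 1) (box τ) Λ = scaledNorm τ (v i) := by
  refine IsLeast.csInf_eq ⟨⟨hv.scaledNorm_pos i, fun j => v (Fin.castLE i.2 j), ?_, fun j =>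
    ⟨hv.mem _, (exists_mem_box_smul_iff (hv.scaledNorm_pos i)).2 (hv.monotone ?_)⟩⟩, ?_⟩
  · exact hv.linearIndependent.comp _ (Fin.castLE_injective _)
  · rw [Fin.le_def]
    simp only [Fin.val_castLE]
    omega
  · rintro r ⟨hr, w, hw, hwr⟩
    have : ∃ j, w j ∉ Submodule.span ℝ (v '' Set.Iio i) := by
      by_contra! hcon
      have h1 : Submodule.span ℝ (Set.range w) ≤ Submodule.span ℝ (v '' Set.Iio i) := by
        rw [Submodule.span_le]
        rintro _ ⟨j, rfl⟩
        exact hcon j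
      have h2 := Submodule.finrank_mono h1
      rw [finrank_span_eq_card hw] at h2
      have h3 := finrank_span_finset_le_card (R := ℝ) ((Finset.Iio i).image v)
      have h4 : ((Finset.Iio i).image v).card ≤ i := by
        refine Finset.card_image_le.trans ?_
        simp
      rw [Set.finrank, Finset.coe_image, Finset.coe_Iio] at h3
      simp at h2
      omega
    obtain ⟨j, hj⟩ := this
    exact (hv.le_of_notMem i _ (hwr j).1 hj).trans
      ((exists_mem_box_smul_iff hr).1 (hwr j).2)

end IsMinimalFamily

/-! ### Upper half of Minkowski's second theorem -/

/-- Gram–Schmidt for the standard inner product of `Fin d → ℝ`, phrased in coordinates. -/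
lemma exists_orthonormal_triangular (v : Fin d → Fin d → ℝ) (hv : LinearIndependent ℝ v) :
    ∃ e : Fin d → Fin d → ℝ, LinearIndependent ℝ e ∧ |(Matrix.of e).det| = 1 ∧
      (∀ i j, |e i j| ≤ 1) ∧
      ∀ i, Submodule.span ℝ (v '' Set.Iio i) = Submodule.span ℝ (e '' Set.Iio i) := by
  let L := (WithLp.linearEquiv 2 ℝ (Fin d → ℝ))
  have hw : LinearIndependent ℝ (L.symm ∘ v) := hv.map' L.symm.toLinearMap L.symm.ker
  let q := InnerProductSpace.gramSchmidtNormed ℝ (L.symm ∘ v)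
  have hq : Orthonormal ℝ q := InnerProductSpace.gramSchmidtNormed_orthonormal hw
  have hspan : ∀ i, Submodule.span ℝ ((L.symm ∘ v) '' Set.Iio i)
      = Submodule.span ℝ (q '' Set.Iio i) := fun i => by
    rw [InnerProductSpace.span_gramSchmidtNormed, InnerProductSpace.span_gramSchmidt_Iio]
  refine ⟨L ∘ q, hq.linearIndependent.map' L.toLinearMap L.ker, ?_, ?_, ?_⟩
  · have hM : Matrix.of (L ∘ q) * (Matrix.of (L ∘ q)).transpose = 1 := by
      ext i j
      have := orthonormal_iff_ite.1 hq j i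
      rw [Matrix.mul_apply, Matrix.one_apply]
      simp only [Matrix.transpose_apply, Matrix.of_apply, Function.comp_apply]
      simpa [PiLp.inner_apply, eq_comm, L] using this
    have h2 := congrArg Matrix.det hM
    rw [Matrix.det_mul, Matrix.det_transpose, Matrix.det_one] at h2
    rw [← abs_one, ← sq_eq_sq_iff_abs_eq_abs, sq, h2, one_pow]
  · intro i j
    have := PiLp.norm_apply_le (q i) j
    rwa [hq.1 i, Real.norm_eq_abs] at this
  · intro i
    have := congrArg (Submodule.map L.toLinearMap) (hspan i)
    rw [Submodule.map_span, Submodule.map_span, ← Set.image_comp, ← Set.image_comp] at this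
    have hLL : (L : WithLp 2 (Fin d → ℝ) → Fin d → ℝ) ∘ L.symm ∘ v = v := by
      ext; simp
    exact hLL ▸ this

lemma mem_span_Iio_of_sum_eq {E : Type*} [AddCommGroup E] [Module ℝ E] {e : Fin d → E}
    {c : Fin d → ℝ} {i : Fin d}
    (he : LinearIndependent ℝ e) (h : ∑ j, c j • e j ∈ Submodule.span ℝ (e '' Set.Iio i)) :
    c i = 0 := by
  obtain ⟨l, hl, hlc⟩ := (Finsupp.mem_span_image_iff_linearCombination ℝ).1 h
  have h1 : ∑ j, c j • e j = Finsupp.linearCombination ℝ e (Finsupp.equivFunOnFinite.symm c) := by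
    rw [Finsupp.linearCombination_apply, Finsupp.sum_fintype _ _ (by simp)]
    simp
  rw [h1] at hlc
  have h2 : l i = c i := by rw [he hlc]; simp
  rw [← h2]
  exact Finsupp.notMem_support_iff.1 fun h3 => lt_irrefl i (hl h3)

/-- The terms beyond i vanish and each of the others is below μ_j / d ≤ μ_i / d; the factor 1 / d
pays for having up to d terms. -/
lemma abs_apply_sum_lt {e : Fin d → Fin d → ℝ} (he : ∀ i j, |e i j| ≤ 1) {c μ : Fin d → ℝ}
    (hd : 0 < d) {i : Fin d} (hμ : ∀ j, 0 < μ j) (hmono : Monotone μ)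
    (hc : ∀ j, |c j| < μ j / d) (hi : ∀ j, i < j → c j = 0) (l : Fin d) :
    |(∑ j, c j • e j) l| < μ i := by
  have hd' : (0 : ℝ) < d := by exact_mod_cast hd
  calc |(∑ j, c j • e j) l| = |∑ j, c j * e j l| := by simp
    _ ≤ ∑ j, |c j * e j l| := Finset.abs_sum_le_sum_abs _ _
    _ < ∑ _j : Fin d, μ i / d := by
        refine Finset.sum_lt_sum_of_nonempty ⟨i, Finset.mem_univ i⟩ fun j _ => ?_
        rw [abs_mul]
        rcases le_or_gt j i with hj | hj
        · calc |c j| * |e j l| ≤ |c j| * 1 := by gcongr; exact he j l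
            _ < μ j / d := by rw [mul_one]; exact hc j
            _ ≤ μ i / d := by gcongr; exact hmono hj
        · rw [hi j hj, abs_zero, zero_mul]
          exact div_pos (hμ i) hd'
    _ = μ i := by
        simp
        field_simp

open MeasureTheory in
/-- Upper half of Minkowski's second theorem (with a non-optimal constant). -/
lemma IsMinimalFamily.prod_scaledNorm_le {τ : Fin d → ℝ} (hd : 0 < d) (hτ : ∑ i, τ i = 0)
    {Λ : Submodule ℤ (Fin d → ℝ)} [DiscreteTopology Λ] [IsZLattice ℝ Λ] {v : Fin d → Fin d → ℝ}
    (hv : IsMinimalFamily τ Λ v) :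
    ∏ i, scaledNorm τ (v i) ≤ (d : ℝ) ^ d * ZLattice.covolume Λ := by
  have hd' : (0 : ℝ) < d := by exact_mod_cast hd
  set D : Matrix (Fin d) (Fin d) ℝ := Matrix.diagonal fun i => Real.exp (τ i) with hD
  set D' : Matrix (Fin d) (Fin d) ℝ := Matrix.diagonal fun i => Real.exp (-τ i) with hD'
  have hDD' : D' * D = 1 := by
    rw [hD, hD', Matrix.diagonal_mul_diagonal, ← Matrix.diagonal_one]
    congr 1
    ext i
    rw [← Real.exp_add, neg_add_cancel, Real.exp_zero]
  have hDD : D * D' = 1 := mul_eq_one_comm.1 hDD'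
  have hnorm : ∀ x, scaledNorm τ x = ‖D'.mulVec x‖ := fun x => by
    rw [scaledNorm]
    congr 1
    ext i
    rw [hD', Matrix.mulVec_diagonal]
  have hker : LinearMap.ker D'.mulVecLin = ⊥ := by
    rw [LinearMap.ker_eq_bot]
    intro x y hxy
    have := congrArg D.mulVec hxy
    simpa [Matrix.mulVec_mulVec, hDD] using this
  obtain ⟨e, heli, hdet, hele, hespan⟩ := exists_orthonormal_triangular _
    (hv.linearIndependent.map' D'.mulVecLin hker)
  set μ : Fin d → ℝ := fun i => scaledNorm τ (v i) with hμ
  have hμpos : ∀ i, 0 < μ i := hv.scaledNorm_pos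
  -- If the product were larger, the parallelepiped with half-axes (μ_i / d) e_i, transported by D,
  -- would have volume exceeding 2^d times the covolume. Here D has determinant 1 because τ has
  -- trace zero.
  by_contra! hlt
  let A : Matrix (Fin d) (Fin d) ℝ :=
    D * ((Matrix.of e).transpose * Matrix.diagonal fun i => μ i / d)
  have hdetA : |A.det| = ∏ i, (μ i / d) := by
    rw [Matrix.det_mul, Matrix.det_mul, Matrix.det_diagonal, Matrix.det_diagonal,
      Matrix.det_transpose, ← Real.exp_sum, hτ, Real.exp_zero, one_mul, abs_mul, hdet, one_mul,
      abs_of_pos (Finset.prod_pos fun i _ => div_pos (hμpos i) hd')]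
  let T : Set (Fin d → ℝ) := Matrix.toLin' A '' Metric.ball 0 1
  have hcountable : Countable Λ.toAddSubgroup := inferInstanceAs (Countable Λ)
  obtain ⟨⟨x, hxΛ⟩, hx0, hxT⟩ := exists_ne_zero_mem_lattice_of_measure_mul_two_pow_lt_measure
    (μ := volume) (L := Λ.toAddSubgroup) (s := T)
    (ZLattice.isAddFundamentalDomain (Module.Free.chooseBasis ℤ Λ) volume) (by
      rintro _ ⟨y, hy, rfl⟩
      exact ⟨-y, by simpa using hy, map_neg _ _⟩)
    ((convex_ball 0 1).linear_image _) (by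
      rw [Measure.addHaar_image_linearMap, LinearMap.det_toLin', Real.volume_pi_ball _ one_pos,
        hdetA]
      have hcov := ZLattice.covolume_eq_measure_fundamentalDomain Λ volume
        (ZLattice.isAddFundamentalDomain (Module.Free.chooseBasis ℤ Λ) volume)
      have hfin : volume (ZSpan.fundamentalDomain
          ((Module.Free.chooseBasis ℤ Λ).ofZLatticeBasis ℝ)) ≠ ⊤ :=
        (Bornology.IsBounded.measure_lt_top (ZSpan.fundamentalDomain_isBounded _)).ne
      rw [← ENNReal.ofReal_toReal hfin, ← measureReal_def, ← hcov, mul_one, Fintype.card_fin,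
        Module.finrank_fin_fun, ← ENNReal.ofReal_ofNat, ← ENNReal.ofReal_pow (by norm_num),
        ← ENNReal.ofReal_mul (ZLattice.covolume_pos Λ volume).le,
        ← ENNReal.ofReal_mul (Finset.prod_nonneg fun i _ => (div_pos (hμpos i) hd').le)]
      rw [ENNReal.ofReal_lt_ofReal_iff (mul_pos
        (Finset.prod_pos fun i _ => div_pos (hμpos i) hd') (by positivity))]
      refine mul_lt_mul_of_pos_right ?_ (by positivity)
      rw [Finset.prod_div_distrib, Finset.prod_const, Finset.card_univ, Fintype.card_fin,
        lt_div_iff₀' (by positivity)]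
      exact hlt)
  obtain ⟨y, hy, hyx⟩ := hxT
  have hx0' : x ≠ 0 := fun h => hx0 (Subtype.ext h)
  set c : Fin d → ℝ := fun i => μ i / d * y i with hc
  have hD'x : D'.mulVec x = ∑ j, c j • e j := by
    simp only at hyx
    rw [← hyx, Matrix.toLin'_apply, Matrix.mulVec_mulVec, ← Matrix.mul_assoc, hDD', Matrix.one_mul,
      ← Matrix.mulVec_mulVec, Matrix.mulVec_transpose]
    ext l
    simp [Matrix.vecMul, dotProduct, Matrix.mulVec_diagonal, hc]
  have hclt : ∀ j, |c j| < μ j / d := fun j => by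
    have h1 : |y j| < 1 := (norm_le_pi_norm y j).trans_lt (by simpa using hy)
    rw [hc, abs_mul, abs_of_pos (div_pos (hμpos j) hd')]
    exact mul_lt_of_lt_one_right (div_pos (hμpos j) hd') h1
  have hcne : ∃ j, c j ≠ 0 := by
    by_contra! h
    refine hx0' ?_
    have h1 : D'.mulVec x = 0 := by simp [hD'x, h]
    rw [← Matrix.one_mulVec x, ← hDD, ← Matrix.mulVec_mulVec, h1, Matrix.mulVec_zero]
  -- Let i be the last index with a nonzero coordinate. Then x has gauge below μ_i, so minimality
  -- puts x in the span of the vectors before `v i`. The two flags agree, which forces c_i = 0.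
  obtain ⟨i, hi, hmax⟩ := Finset.exists_max_image (Finset.univ.filter fun j => c j ≠ 0) id
    (by obtain ⟨j, hj⟩ := hcne; exact ⟨j, by simpa using hj⟩)
  have hci : c i ≠ 0 := by simpa using hi
  have hlast : ∀ j, i < j → c j = 0 := fun j hj => by
    by_contra h
    exact absurd (hmax j (by simpa using h)) (not_le.2 hj)
  have hxlt : scaledNorm τ x < scaledNorm τ (v i) := by
    rw [hnorm x, hD'x, pi_norm_lt_iff (hμpos i)]
    exact abs_apply_sum_lt hele hd hμpos hv.monotone hclt hlast
  have hmem : x ∈ Submodule.span ℝ (v '' Set.Iio i) := by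
    by_contra h
    exact absurd (hv.le_of_notMem i x hxΛ h) (not_le.2 hxlt)
  have hmem' := Submodule.mem_map_of_mem (f := D'.mulVecLin) hmem
  rw [Submodule.map_span, ← Set.image_comp, hespan, Matrix.mulVecLin_apply, hD'x] at hmem'
  exact hci (mem_span_Iio_of_sum_eq heli hmem')

/-! ### The dual lattice and the easy half of Mahler's duality -/

/-- The dual of a ℤ-basis of Λ serves. Hence Λ* is again a full lattice, and the Minkowski bound
applies to it as well. -/
lemma exists_dualLattice_eq_span (Λ : Submodule ℤ (Fin d → ℝ)) [DiscreteTopology Λ]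
    [IsZLattice ℝ Λ] :
    ∃ b : Module.Basis (Fin d) ℝ (Fin d → ℝ),
      dualLattice Λ = Submodule.span ℤ (Set.range b) := by
  let B : LinearMap.BilinForm ℝ (Fin d → ℝ) := dotProductBilin ℝ ℝ
  have hB : B.Nondegenerate := by
    constructor
    · intro x hx
      exact dotProduct_eq_zero _ hx
    · intro y hy
      exact dotProduct_eq_zero _ fun w => (dotProduct_comm _ _).trans (hy w)
  let b₀ := (Module.Free.chooseBasis ℤ Λ).ofZLatticeBasis ℝ
  let b : Module.Basis (Fin d) ℝ (Fin d → ℝ) := b₀.reindex (b₀.indexEquiv (Pi.basisFun ℝ (Fin d)))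
  have hb : Submodule.span ℤ (Set.range b) = Λ := by
    rw [Module.Basis.range_reindex]
    exact (Module.Free.chooseBasis ℤ Λ).ofZLatticeBasis_span ℝ
  refine ⟨B.dualBasis hB b, ?_⟩
  rw [← LinearMap.BilinForm.dualSubmodule_span_of_basis, hb]
  ext y
  refine forall₂_congr fun x _ => ?_
  rw [Submodule.mem_one]
  refine exists_congr fun n => ?_
  rw [eq_comm]
  rfl

instance discreteTopology_dualLattice (Λ : Submodule ℤ (Fin d → ℝ)) [DiscreteTopology Λ]
    [IsZLattice ℝ Λ] : DiscreteTopology (dualLattice Λ) := by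
  obtain ⟨b, hb⟩ := exists_dualLattice_eq_span Λ
  rw [hb]
  infer_instance

instance isZLattice_dualLattice (Λ : Submodule ℤ (Fin d → ℝ)) [DiscreteTopology Λ]
    [IsZLattice ℝ Λ] : IsZLattice ℝ (dualLattice Λ) := by
  obtain ⟨b, hb⟩ := exists_dualLattice_eq_span Λ
  constructor
  rw [hb, ZSpan.span_top]

lemma abs_dotProduct_le (τ x y : Fin d → ℝ) :
    |y ⬝ᵥ x| ≤ d * (scaledNorm τ x * scaledNorm (-τ) y) := by
  calc |y ⬝ᵥ x| ≤ ∑ i, |y i * x i| := Finset.abs_sum_le_sum_abs _ _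
    _ ≤ ∑ _i : Fin d, scaledNorm τ x * scaledNorm (-τ) y := by
        refine Finset.sum_le_sum fun i _ => ?_
        rw [abs_mul]
        have h1 := abs_apply_le τ x i
        have h2 := abs_apply_le (-τ) y i
        calc |y i| * |x i|
            ≤ (Real.exp ((-τ) i) * scaledNorm (-τ) y) * (Real.exp (τ i) * scaledNorm τ x) :=
              mul_le_mul h2 h1 (abs_nonneg _)
                (mul_nonneg (Real.exp_pos _).le (scaledNorm_nonneg _ _))
          _ = (Real.exp ((-τ) i) * Real.exp (τ i)) * (scaledNorm τ x * scaledNorm (-τ) y) := by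
              ring
          _ = _ := by rw [← Real.exp_add]; simp
    _ = _ := by simp

/-- The two initial segments span subspaces of dimensions i + 1 and d - i. These add up to d + 1,
too much for orthogonal subspaces of ℝ^d. -/
lemma exists_dotProduct_ne_zero {v w : Fin d → Fin d → ℝ} (hv : LinearIndependent ℝ v)
    (hw : LinearIndependent ℝ w) (i : Fin d) : ∃ a ≤ i, ∃ b ≤ i.rev, w b ⬝ᵥ v a ≠ 0 := by
  by_contra! hcon
  let V : Matrix (Set.Iic i) (Fin d) ℝ := Matrix.of fun a => v a
  let W : Matrix (Set.Iic i.rev) (Fin d) ℝ := Matrix.of fun b => w b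
  have hV : V.rank = Fintype.card (Set.Iic i) :=
    LinearIndependent.rank_matrix (hv.comp _ Subtype.val_injective)
  have hW : W.rank = Fintype.card (Set.Iic i.rev) :=
    LinearIndependent.rank_matrix (hw.comp _ Subtype.val_injective)
  have h0 : W * V.transpose = 0 := by
    ext b a
    exact hcon a a.2 b b.2
  have h1 := Matrix.rank_add_rank_le_card_of_mul_eq_zero h0
  rw [Matrix.rank_transpose, hV, hW] at h1
  simp [Fin.val_rev] at h1
  omega

/-- A nonzero pairing of a lattice vector with a dual vector is an integer, so it is at least 1 in
absolute value; monotonicity of the minima then moves the bound to the extreme indices. -/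
lemma IsMinimalFamily.one_le_mul_scaledNorm_rev {τ : Fin d → ℝ} {Λ : Submodule ℤ (Fin d → ℝ)}
    {v w : Fin d → Fin d → ℝ} (hv : IsMinimalFamily τ Λ v)
    (hw : IsMinimalFamily (-τ) (dualLattice Λ) w) (i : Fin d) :
    1 ≤ d * (scaledNorm τ (v i) * scaledNorm (-τ) (w i.rev)) := by
  obtain ⟨a, ha, b, hb, hab⟩ := exists_dotProduct_ne_zero hv.linearIndependent
    hw.linearIndependent i
  obtain ⟨n, hn⟩ := hw.mem b (v a) (hv.mem a)
  have hn0 : n ≠ 0 := by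
    rintro rfl
    exact hab (by simpa using hn)
  calc (1 : ℝ) ≤ |(n : ℝ)| := by exact_mod_cast Int.one_le_abs hn0
    _ ≤ d * (scaledNorm τ (v a) * scaledNorm (-τ) (w b)) := by
        rw [← hn]
        exact abs_dotProduct_le _ _ _
    _ ≤ _ := by
        refine mul_le_mul_of_nonneg_left ?_ (Nat.cast_nonneg d)
        exact mul_le_mul (hv.monotone ha) (hw.monotone hb) (scaledNorm_nonneg _ _)
          (scaledNorm_nonneg _ _)

/-! ### Uniform bounds on the logarithmic scale -/

lemma logMinimum_mono (τ : traceZero d) (Λ : Submodule ℤ (Fin d → ℝ)) [DiscreteTopology Λ]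
    [IsZLattice ℝ Λ] {j k : ℕ} (hj : 1 ≤ j) (hjk : j ≤ k) (hk : k ≤ d) :
    logMinimum j τ Λ ≤ logMinimum k τ Λ := by
  obtain ⟨v, hv⟩ := exists_isMinimalFamily (τ : Fin d → ℝ) Λ
  have h1 := hv.successiveMinimum_eq ⟨j - 1, by omega⟩
  have h2 := hv.successiveMinimum_eq ⟨k - 1, by omega⟩
  simp only [Nat.sub_add_cancel hj, Nat.sub_add_cancel (hj.trans hjk)] at h1 h2
  rw [logMinimum, logMinimum, h1, h2]
  refine Real.log_le_log (hv.scaledNorm_pos _) (hv.monotone ?_)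
  simp only [Fin.mk_le_mk]
  omega

lemma sum_logMinimum_le (hd : 0 < d) (τ : traceZero d) (Λ : Submodule ℤ (Fin d → ℝ))
    [DiscreteTopology Λ] [IsZLattice ℝ Λ] :
    ∑ i : Fin d, logMinimum (i + 1) τ Λ ≤ Real.log ((d : ℝ) ^ d * ZLattice.covolume Λ) := by
  obtain ⟨v, hv⟩ := exists_isMinimalFamily (τ : Fin d → ℝ) Λ
  simp only [logMinimum, hv.successiveMinimum_eq]
  rw [← Real.log_prod fun i _ => (hv.scaledNorm_pos i).ne']
  exact Real.log_le_log (Finset.prod_pos fun i _ => hv.scaledNorm_pos i)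
    (hv.prod_scaledNorm_le hd τ.2)

lemma neg_log_le_logMinimum_add (τ : traceZero d) (Λ : Submodule ℤ (Fin d → ℝ))
    [DiscreteTopology Λ] [IsZLattice ℝ Λ] (i : Fin d) :
    -Real.log d ≤ logMinimum (i + 1) τ Λ + logMinimum (i.rev + 1) (-τ) (dualLattice Λ) := by
  obtain ⟨v, hv⟩ := exists_isMinimalFamily (τ : Fin d → ℝ) Λ
  obtain ⟨w, hw⟩ := exists_isMinimalFamily (-τ : Fin d → ℝ) (dualLattice Λ)
  have hd : (0 : ℝ) < d := by exact_mod_cast i.pos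
  have h2 := hw.successiveMinimum_eq i.rev
  rw [logMinimum, logMinimum, hv.successiveMinimum_eq, NegMemClass.coe_neg, h2,
    ← Real.log_mul (hv.scaledNorm_pos _).ne' (hw.scaledNorm_pos _).ne', ← Real.log_inv]
  refine Real.log_le_log (inv_pos.2 hd) ?_
  rw [inv_le_iff_one_le_mul₀' hd]
  exact hv.one_le_mul_scaledNorm_rev hw i

lemma sum_Icc_one_eq_sum_fin (g : ℕ → ℝ) (n : ℕ) :
    ∑ j ∈ Finset.Icc 1 n, g j = ∑ i : Fin n, g (i + 1) := by
  rw [Fin.sum_univ_eq_sum_range fun i => g (i + 1)]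
  induction n with
  | zero => simp
  | succ n ih => rw [Finset.sum_Icc_succ_top (by omega), Finset.sum_range_succ, ih]

/-- Minkowski's second theorem and Mahler's duality for the successive minima of the boxes
`box τ`, up to an additive constant on the logarithmic scale that is uniform in `τ`. -/
lemma exists_bound_logMinimum (hd : 0 < d) (Λ : Submodule ℤ (Fin d → ℝ))
    [DiscreteTopology Λ] [IsZLattice ℝ Λ] :
    ∃ C : ℝ, ∀ τ : traceZero d,
      |∑ j ∈ Finset.Icc 1 d, logMinimum j τ Λ| ≤ C ∧
      |∑ j ∈ Finset.Icc 1 d, logMinimum j (-τ) (dualLattice Λ)| ≤ C ∧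
      ∀ k, 1 ≤ k → k ≤ d →
        |logMinimum k τ Λ + logMinimum (d + 1 - k) (-τ) (dualLattice Λ)| ≤ C := by
  set p := Real.log ((d : ℝ) ^ d * ZLattice.covolume Λ)
  set q := Real.log ((d : ℝ) ^ d * ZLattice.covolume (dualLattice Λ))
  have hlog : 0 ≤ Real.log d := Real.log_natCast_nonneg d
  have hdlog : Real.log d ≤ d * Real.log d :=
    le_mul_of_one_le_left hlog (by exact_mod_cast hd)
  refine ⟨|p| + |q| + d * Real.log d, fun τ => ?_⟩
  have hx := sum_logMinimum_le hd τ Λ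
  have hy := sum_logMinimum_le hd (-τ) (dualLattice Λ)
  have hxy := neg_log_le_logMinimum_add τ Λ
  rw [sum_Icc_one_eq_sum_fin fun j => logMinimum j τ Λ,
    sum_Icc_one_eq_sum_fin fun j => logMinimum j (-τ) (dualLattice Λ)]
  set x : Fin d → ℝ := fun i => logMinimum (i + 1) τ Λ
  set y : Fin d → ℝ := fun i => logMinimum (i + 1) (-τ) (dualLattice Λ)
  change ∀ i, -Real.log d ≤ x i + y i.rev at hxy
  have hrev : ∑ i : Fin d, y i.rev = ∑ i, y i := Equiv.sum_comp Fin.revPerm y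
  -- Nonnegative terms with total at most p + q + d log d: nonnegativity of the total bounds each of
  -- the two sums from below, and each single term is at most the total, which is the hard half of
  -- the duality.
  have hnn : ∀ i, 0 ≤ x i + y i.rev + Real.log d := fun i => by linarith [hxy i]
  have htot : ∑ i, (x i + y i.rev + Real.log d) = ∑ i, x i + ∑ i, y i + d * Real.log d := by
    rw [Finset.sum_add_distrib, Finset.sum_add_distrib, hrev]
    simp
  have htot0 : 0 ≤ ∑ i, (x i + y i.rev + Real.log d) := Finset.sum_nonneg fun i _ => hnn i
  have hp := le_abs_self p
  have hq := le_abs_self q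
  have hp0 := abs_nonneg p
  have hq0 := abs_nonneg q
  refine ⟨abs_le.2 ⟨by linarith, by linarith⟩, abs_le.2 ⟨by linarith, by linarith⟩,
    fun k hk hkd => ?_⟩
  let i : Fin d := ⟨k - 1, by omega⟩
  have h1 := hxy i
  have h2 := Finset.single_le_sum (fun i _ => hnn i) (Finset.mem_univ i)
  have e1 : x i = logMinimum k τ Λ := by
    simp only [x, i, Nat.sub_add_cancel hk]
  have e2 : y i.rev = logMinimum (d + 1 - k) (-τ) (dualLattice Λ) := by
    have : (i.rev : ℕ) + 1 = d + 1 - k := by simp only [i, Fin.val_rev]; omega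
    simp only [y, this]
  simp only [htot] at h2
  rw [← e1, ← e2]
  exact abs_le.2 ⟨by linarith, by linarith⟩

/-! ### Limits in the extended reals and bounded perturbations -/

section ERealLimits

variable {α : Type*} {F : Filter α} {u w e : α → ℝ}

lemma limsup_coe_le_of_le_add [F.NeBot] (h : ∀ᶠ a in F, u a ≤ w a + e a) (he : Tendsto e F (nhds 0)) :
    limsup (fun a => (u a : EReal)) F ≤ limsup (fun a => (w a : EReal)) F := by
  have he' : limsup (fun a => (e a : EReal)) F = 0 :=
    ((continuous_coe_real_ereal.tendsto 0).comp he).limsup_eq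
  calc limsup (fun a => (u a : EReal)) F
      ≤ limsup ((fun a => (w a : EReal)) + fun a => (e a : EReal)) F := by
        refine limsup_le_limsup ?_
        filter_upwards [h] with a ha
        simpa only [Pi.add_apply, ← EReal.coe_add, EReal.coe_le_coe_iff] using ha
    _ ≤ limsup (fun a => (w a : EReal)) F + limsup (fun a => (e a : EReal)) F :=
        EReal.limsup_add_le (by simp [he']) (by simp [he'])
    _ = _ := by rw [he', add_zero]

/-- The error goes through its limsup, since liminf (e + w) ≤ limsup e + liminf w. That limsup is 0,
which rules out indeterminate sums even when the other limit is infinite. -/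
lemma liminf_coe_le_of_le_add [F.NeBot] (h : ∀ᶠ a in F, u a ≤ w a + e a) (he : Tendsto e F (nhds 0)) :
    liminf (fun a => (u a : EReal)) F ≤ liminf (fun a => (w a : EReal)) F := by
  have he' : limsup (fun a => (e a : EReal)) F = 0 :=
    ((continuous_coe_real_ereal.tendsto 0).comp he).limsup_eq
  calc liminf (fun a => (u a : EReal)) F
      ≤ liminf ((fun a => (e a : EReal)) + fun a => (w a : EReal)) F := by
        refine liminf_le_liminf ?_
        filter_upwards [h] with a ha
        rw [add_comm] at ha
        simpa only [Pi.add_apply, ← EReal.coe_add, EReal.coe_le_coe_iff] using ha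
    _ ≤ limsup (fun a => (e a : EReal)) F + liminf (fun a => (w a : EReal)) F :=
        EReal.liminf_add_le (by simp [he']) (by simp [he'])
    _ = _ := by rw [he', zero_add]

lemma limsup_coe_const_mul [F.NeBot] {c : ℝ} (hc : 0 ≤ c) :
    limsup (fun a => ((c * u a : ℝ) : EReal)) F = c * limsup (fun a => (u a : EReal)) F := by
  simp only [EReal.coe_mul]
  exact EReal.limsup_const_mul_of_nonneg_of_ne_top (by exact_mod_cast hc) (EReal.coe_ne_top c)

lemma liminf_coe_const_mul [F.NeBot] {c : ℝ} (hc : 0 ≤ c) :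
    liminf (fun a => ((c * u a : ℝ) : EReal)) F = c * liminf (fun a => (u a : EReal)) F := by
  simp only [EReal.coe_mul]
  exact EReal.liminf_const_mul_of_nonneg_of_ne_top (by exact_mod_cast hc) (EReal.coe_ne_top c)

lemma limsup_coe_neg : limsup (fun a => ((-u a : ℝ) : EReal)) F
    = -liminf (fun a => (u a : EReal)) F := by
  simp only [EReal.coe_neg]
  exact EReal.limsup_neg

lemma liminf_coe_neg : liminf (fun a => ((-u a : ℝ) : EReal)) F
    = -limsup (fun a => (u a : EReal)) F := by
  simp only [EReal.coe_neg]
  exact EReal.liminf_neg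

end ERealLimits

/-- For d ≥ 2 the hyperplane contains a nonzero vector, so it is unbounded and the limits are taken
along a proper filter. -/
lemma neBot_cobounded_traceZero (hd : 2 ≤ d) :
    (Bornology.cobounded (traceZero d)).NeBot := by
  have hne : (⟨0, by omega⟩ : Fin d) ≠ ⟨1, by omega⟩ := by simp
  have : Nontrivial (traceZero d) := by
    refine ⟨⟨⟨Pi.single ⟨0, by omega⟩ 1 - Pi.single ⟨1, by omega⟩ 1, ?_⟩, 0, fun h => ?_⟩⟩
    · change ∑ i, _ = (0 : ℝ)
      simp
    · have := congrFun (congrArg Subtype.val h) ⟨0, by omega⟩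
      simp at this
  exact NormedSpace.cobounded_neBot ℝ _

namespace IsExhausting

variable {f : traceZero d → ℝ}

lemma tendsto_atTop (hf : IsExhausting f) :
    Tendsto f (Bornology.cobounded (traceZero d)) atTop := by
  refine Filter.tendsto_atTop.2 fun r => ?_
  have : {τ | f τ ≤ r}ᶜ ∈ Bornology.cobounded (traceZero d) :=
    Bornology.isBounded_def.1 (hf.isBounded_sublevel r)
  filter_upwards [this] with τ hτ
  have h : r < f τ := by simpa using hτ
  exact h.le

lemma tendsto_const_div (hf : IsExhausting f) (C : ℝ) :
    Tendsto (fun τ => C / f τ) (Bornology.cobounded (traceZero d)) (nhds 0) :=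
  hf.tendsto_atTop.const_div_atTop C

lemma eventually_div_le (hf : IsExhausting f) {A B : traceZero d → ℝ} {C : ℝ}
    (h : ∀ τ, A τ ≤ B τ + C) :
    ∀ᶠ τ in Bornology.cobounded (traceZero d), A τ / f τ ≤ B τ / f τ + C / f τ :=
  -- Where f vanishes, division by zero makes both sides 0, so the inequality holds at every τ.
  Eventually.of_forall fun τ => by
    rw [← add_div]
    exact div_le_div_of_nonneg_right (h τ) (hf.nonneg τ)

lemma liminf_div_le (hf : IsExhausting f) (hd : 2 ≤ d) {A B : traceZero d → ℝ} {C : ℝ}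
    (h : ∀ τ, A τ ≤ B τ + C) :
    liminf (fun τ => ((A τ / f τ : ℝ) : EReal)) (Bornology.cobounded _) ≤
      liminf (fun τ => ((B τ / f τ : ℝ) : EReal)) (Bornology.cobounded _) :=
  have := neBot_cobounded_traceZero hd
  liminf_coe_le_of_le_add (hf.eventually_div_le h) (hf.tendsto_const_div C)

lemma limsup_div_le (hf : IsExhausting f) (hd : 2 ≤ d) {A B : traceZero d → ℝ} {C : ℝ}
    (h : ∀ τ, A τ ≤ B τ + C) :
    limsup (fun τ => ((A τ / f τ : ℝ) : EReal)) (Bornology.cobounded _) ≤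
      limsup (fun τ => ((B τ / f τ : ℝ) : EReal)) (Bornology.cobounded _) :=
  have := neBot_cobounded_traceZero hd
  limsup_coe_le_of_le_add (hf.eventually_div_le h) (hf.tendsto_const_div C)

lemma liminf_div_eq (hf : IsExhausting f) (hd : 2 ≤ d) {A B : traceZero d → ℝ} {C : ℝ}
    (h : ∀ τ, |A τ - B τ| ≤ C) :
    liminf (fun τ => ((A τ / f τ : ℝ) : EReal)) (Bornology.cobounded _) =
      liminf (fun τ => ((B τ / f τ : ℝ) : EReal)) (Bornology.cobounded _) :=
  le_antisymm (hf.liminf_div_le hd (C := C) fun τ => by linarith [(abs_le.1 (h τ)).2])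
    (hf.liminf_div_le hd (C := C) fun τ => by linarith [(abs_le.1 (h τ)).1])

lemma limsup_div_eq (hf : IsExhausting f) (hd : 2 ≤ d) {A B : traceZero d → ℝ} {C : ℝ}
    (h : ∀ τ, |A τ - B τ| ≤ C) :
    limsup (fun τ => ((A τ / f τ : ℝ) : EReal)) (Bornology.cobounded _) =
      limsup (fun τ => ((B τ / f τ : ℝ) : EReal)) (Bornology.cobounded _) :=
  le_antisymm (hf.limsup_div_le hd (C := C) fun τ => by linarith [(abs_le.1 (h τ)).2])
    (hf.limsup_div_le hd (C := C) fun τ => by linarith [(abs_le.1 (h τ)).1])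

/-- If `A + B` is bounded, then `liminf A / f = - limsup B / f`. -/
lemma liminf_div_eq_neg_limsup (hf : IsExhausting f) (hd : 2 ≤ d) {A B : traceZero d → ℝ} {C : ℝ}
    (h : ∀ τ, |A τ + B τ| ≤ C) :
    liminf (fun τ => ((A τ / f τ : ℝ) : EReal)) (Bornology.cobounded _) =
      -limsup (fun τ => ((B τ / f τ : ℝ) : EReal)) (Bornology.cobounded _) := by
  rw [← liminf_coe_neg]
  simp only [← neg_div]
  exact hf.liminf_div_eq hd (C := C) fun τ => by simpa using h τ

/-- If `A + B` is bounded, then `limsup A / f = - liminf B / f`. -/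
lemma limsup_div_eq_neg_liminf (hf : IsExhausting f) (hd : 2 ≤ d) {A B : traceZero d → ℝ} {C : ℝ}
    (h : ∀ τ, |A τ + B τ| ≤ C) :
    limsup (fun τ => ((A τ / f τ : ℝ) : EReal)) (Bornology.cobounded _) =
      -liminf (fun τ => ((B τ / f τ : ℝ) : EReal)) (Bornology.cobounded _) := by
  rw [← limsup_coe_neg]
  simp only [← neg_div]
  exact hf.limsup_div_eq hd (C := C) fun τ => by simpa using h τ

end IsExhausting

/-! ### Partial sums of log-minima and the reflection τ ↦ -τ -/

/-- `∑_{1 ≤ j ≤ k} L_j(τ, Λ)`. -/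
def sumLogMinimum (k : ℕ) (τ : traceZero d) (Λ : Submodule ℤ (Fin d → ℝ)) : ℝ :=
  ∑ j ∈ Finset.Icc 1 k, logMinimum j τ Λ

lemma sumLogMinimum_succ (k : ℕ) (τ : traceZero d) (Λ : Submodule ℤ (Fin d → ℝ)) :
    sumLogMinimum (k + 1) τ Λ = sumLogMinimum k τ Λ + logMinimum (k + 1) τ Λ :=
  Finset.sum_Icc_succ_top (by omega) _

lemma bigPsi_eq (k : ℕ) (τ : traceZero d) (Λ : Submodule ℤ (Fin d → ℝ)) (f : traceZero d → ℝ) :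
    bigPsi k τ Λ f = sumLogMinimum k τ Λ / f τ :=
  (Finset.sum_div _ _ _).symm

section Exponents

variable (k : ℕ) (Λ : Submodule ℤ (Fin d → ℝ)) (f : traceZero d → ℝ)

lemma lowerExp₂_eq : lowerExp₂ k Λ f =
    liminf (fun τ => ((sumLogMinimum k τ Λ / f τ : ℝ) : EReal)) (Bornology.cobounded _) := by
  simp only [lowerExp₂, bigPsi_eq]

lemma upperExp₂_eq : upperExp₂ k Λ f =
    limsup (fun τ => ((sumLogMinimum k τ Λ / f τ : ℝ) : EReal)) (Bornology.cobounded _) := by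
  simp only [upperExp₂, bigPsi_eq]

lemma map_neg_cobounded :
    map (fun τ => -τ) (Bornology.cobounded (traceZero d)) = Bornology.cobounded (traceZero d) :=
  Filter.neg_cobounded

/-- Negation preserves the cobounded filter, so τ may be replaced by -τ under the limit. -/
lemma liminf_reflect (g : traceZero d → ℝ) :
    liminf (fun τ => ((g τ / reflect f τ : ℝ) : EReal)) (Bornology.cobounded _) =
      liminf (fun τ => ((g (-τ) / f τ : ℝ) : EReal)) (Bornology.cobounded _) := by
  conv_lhs => rw [← map_neg_cobounded]
  simp only [liminf, Filter.map_map, Function.comp_def, reflect, neg_neg]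

lemma limsup_reflect (g : traceZero d → ℝ) :
    limsup (fun τ => ((g τ / reflect f τ : ℝ) : EReal)) (Bornology.cobounded _) =
      limsup (fun τ => ((g (-τ) / f τ : ℝ) : EReal)) (Bornology.cobounded _) := by
  conv_lhs => rw [← map_neg_cobounded]
  simp only [limsup, Filter.map_map, Function.comp_def, reflect, neg_neg]

end Exponents

section SumInequalities

variable (τ : traceZero d) (Λ : Submodule ℤ (Fin d → ℝ)) [DiscreteTopology Λ] [IsZLattice ℝ Λ]

lemma sumLogMinimum_le_mul {k : ℕ} (hkd : k + 1 ≤ d) :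
    sumLogMinimum k τ Λ ≤ k * logMinimum (k + 1) τ Λ := by
  refine (Finset.sum_le_card_nsmul _ _ (logMinimum (k + 1) τ Λ) fun j hj => ?_).trans (by simp)
  rw [Finset.mem_Icc] at hj
  exact logMinimum_mono τ Λ hj.1 (by omega) hkd

lemma mul_le_sumLogMinimum {k : ℕ} (hkd : k ≤ d) :
    k * logMinimum 1 τ Λ ≤ sumLogMinimum k τ Λ := by
  refine le_trans (by simp) (Finset.card_nsmul_le_sum _ _ (logMinimum 1 τ Λ) fun j hj => ?_)
  rw [Finset.mem_Icc] at hj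
  exact logMinimum_mono τ Λ le_rfl hj.1 (by omega)

lemma sub_mul_logMinimum_succ_le {k m : ℕ} (hkm : k ≤ m) (hm : m ≤ d) :
    ((m : ℝ) - k) * logMinimum (k + 1) τ Λ ≤ sumLogMinimum m τ Λ - sumLogMinimum k τ Λ := by
  induction m, hkm using Nat.le_induction with
  | base => simp
  | succ m hkm ih =>
    have h1 := ih (by omega)
    have h2 := logMinimum_mono τ Λ (j := k + 1) (k := m + 1) (by omega) (by omega) hm
    rw [sumLogMinimum_succ]
    push_cast
    linarith

lemma sumLogMinimum_sub_le_mul {k m : ℕ} (hk : k ≤ m) (hm : m ≤ d) :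
    sumLogMinimum m τ Λ - sumLogMinimum k τ Λ ≤ ((m : ℝ) - k) * logMinimum m τ Λ := by
  have h : ∀ n, k ≤ n → n ≤ m →
      sumLogMinimum n τ Λ - sumLogMinimum k τ Λ ≤ ((n : ℝ) - k) * logMinimum m τ Λ := by
    intro n hkn
    induction n, hkn using Nat.le_induction with
    | base => simp
    | succ n hkn ih =>
      intro hn
      have h1 := ih (by omega)
      have h2 := logMinimum_mono τ Λ (j := n + 1) (k := m) (by omega) hn hm
      rw [sumLogMinimum_succ]
      push_cast
      linarith
  exact h m hk le_rfl

/-- With S_k the partial sums, the average of the k smallest terms is at most the overall average: d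
S_k ≤ k S_d. -/
lemma sumLogMinimum_le {k : ℕ} {C : ℝ} (hkd : k + 1 ≤ d) (hC : |sumLogMinimum d τ Λ| ≤ C) :
    sumLogMinimum k τ Λ ≤ C := by
  have h1 := sumLogMinimum_le_mul τ Λ hkd
  have h2 := sub_mul_logMinimum_succ_le τ Λ (k := k) (by omega) le_rfl
  have hkd' : (k : ℝ) + 1 ≤ d := by exact_mod_cast hkd
  have hk0 : (0 : ℝ) ≤ k := Nat.cast_nonneg k
  have hC0 : 0 ≤ C := (abs_nonneg _).trans hC
  have hC1 := (abs_le.1 hC).2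
  have h3 : (d : ℝ) * sumLogMinimum k τ Λ ≤ k * sumLogMinimum d τ Λ := by
    nlinarith
  have h4 : (d : ℝ) * sumLogMinimum k τ Λ ≤ d * C := by nlinarith
  exact le_of_mul_le_mul_left h4 (by linarith)

lemma mul_sumLogMinimum_le_succ {k : ℕ} (hk : 1 ≤ k) (hkd : k + 1 ≤ d) :
    ((k : ℝ) + 1) / k * sumLogMinimum k τ Λ ≤ sumLogMinimum (k + 1) τ Λ := by
  have hk' : (0 : ℝ) < k := by exact_mod_cast hk
  have h1 := sumLogMinimum_le_mul τ Λ hkd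
  rw [sumLogMinimum_succ, div_mul_eq_mul_div, div_le_iff₀ hk']
  linarith

/-- L_{k+1} is at most the average (S_d - S_k) / (d - k) of the remaining terms; S_d / (d - k) is
absorbed in C because d - k ≥ 1. -/
lemma sumLogMinimum_succ_le {k : ℕ} {C : ℝ} (hkd : k + 1 ≤ d) (hC : |sumLogMinimum d τ Λ| ≤ C) :
    sumLogMinimum (k + 1) τ Λ ≤
      ((d : ℝ) - k - 1) / ((d : ℝ) - k) * sumLogMinimum k τ Λ + C := by
  have hkd' : (k : ℝ) + 1 ≤ d := by exact_mod_cast hkd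
  have hpos : (0 : ℝ) < (d : ℝ) - k := by linarith
  have h2 := sub_mul_logMinimum_succ_le τ Λ (k := k) (by omega) le_rfl
  have hC0 : 0 ≤ C := (abs_nonneg _).trans hC
  have hC1 := (abs_le.1 hC).2
  rw [sumLogMinimum_succ, div_mul_eq_mul_div, div_add' _ _ _ hpos.ne', le_div_iff₀ hpos]
  nlinarith

/-- S_{d-1} = S_d - L_d, and L_d is at least the average (S_d - S_1) / (d - 1) of the terms after
the first. -/
lemma sumLogMinimum_pred_le {C : ℝ} (hd : 2 ≤ d) (hC : |sumLogMinimum d τ Λ| ≤ C) :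
    sumLogMinimum (d - 1) τ Λ ≤ ((d : ℝ) - 1)⁻¹ * sumLogMinimum 1 τ Λ + C := by
  have hd' : (2 : ℝ) ≤ d := by exact_mod_cast hd
  have hpos : (0 : ℝ) < (d : ℝ) - 1 := by linarith
  have h1 := sumLogMinimum_sub_le_mul τ Λ (k := 1) (m := d) (by omega) le_rfl
  have h2 := sumLogMinimum_succ (d - 1) τ Λ
  rw [Nat.sub_add_cancel (by omega)] at h2
  have hC0 : 0 ≤ C := (abs_nonneg _).trans hC
  have hC1 := (abs_le.1 hC).2
  push_cast at h1
  rw [inv_mul_eq_div, div_add' _ _ _ hpos.ne', le_div_iff₀ hpos]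
  nlinarith

end SumInequalities

lemma sum_logMinimum_rev (τ : traceZero d) (Λ : Submodule ℤ (Fin d → ℝ)) {k : ℕ} (hk : k ≤ d) :
    ∑ j ∈ Finset.Icc 1 k, logMinimum (d + 1 - j) τ Λ
      = sumLogMinimum d τ Λ - sumLogMinimum (d - k) τ Λ := by
  induction k with
  | zero => simp
  | succ k ih =>
    have h := sumLogMinimum_succ (d - (k + 1)) τ Λ
    rw [show d - (k + 1) + 1 = d - k by omega] at h
    rw [Finset.sum_Icc_succ_top (by omega), ih (by omega), h,
      show d + 1 - (k + 1) = d - k by omega]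
    ring

/-- The first k terms for Λ are, up to sign and O(1), the last k terms for Λ'. Those equal the full
sum, itself O(1), minus the first d - k terms. -/
lemma abs_sumLogMinimum_sub_dual_le {τ : traceZero d} {Λ Λ' : Submodule ℤ (Fin d → ℝ)} {C : ℝ}
    (hS : |sumLogMinimum d (-τ) Λ'| ≤ C)
    (hL : ∀ k, 1 ≤ k → k ≤ d → |logMinimum k τ Λ + logMinimum (d + 1 - k) (-τ) Λ'| ≤ C)
    {k : ℕ} (hk : k ≤ d) :
    |sumLogMinimum k τ Λ - sumLogMinimum (d - k) (-τ) Λ'| ≤ k * C + C := by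
  have h1 := sum_logMinimum_rev (-τ) Λ' hk
  have h2 : |∑ j ∈ Finset.Icc 1 k, (logMinimum j τ Λ + logMinimum (d + 1 - j) (-τ) Λ')|
      ≤ k * C := by
    refine (Finset.abs_sum_le_sum_abs _ _).trans ?_
    refine (Finset.sum_le_card_nsmul _ _ C fun j hj => ?_).trans (by simp)
    rw [Finset.mem_Icc] at hj
    exact hL j hj.1 (hj.2.trans hk)
  rw [Finset.sum_add_distrib, h1] at h2
  change |sumLogMinimum k τ Λ + _| ≤ _ at h2
  calc _ = |(sumLogMinimum k τ Λ + (sumLogMinimum d (-τ) Λ' - sumLogMinimum (d - k) (-τ) Λ'))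
        - sumLogMinimum d (-τ) Λ'| := by ring_nf
    _ ≤ _ := (abs_sub _ _).trans (add_le_add h2 hS)

end LatticeExponents

end

/-! ### Assembling the relations between exponents -/

open LatticeExponents in
theorem mainTheorem7 (d : ℕ) (hd : 2 ≤ d)
    (Λ : Submodule ℤ (Fin d → ℝ)) [DiscreteTopology Λ] [IsZLattice ℝ Λ]
    (hΛ : ZLattice.covolume Λ = 1)
    (f : LatticeExponents.traceZero d → ℝ) (hf : LatticeExponents.IsExhausting f) :
    (∀ k : ℕ, 1 ≤ k → k ≤ d - 1 →
      LatticeExponents.lowerExp₁ k Λ f ≤ LatticeExponents.lowerExp₁ (k + 1) Λ f ∧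
      LatticeExponents.upperExp₁ k Λ f ≤ LatticeExponents.upperExp₁ (k + 1) Λ f) ∧
    (LatticeExponents.lowerExp₂ 1 Λ f = LatticeExponents.lowerExp₁ 1 Λ f ∧
      LatticeExponents.lowerExp₁ 1 Λ f ≤ 0 ∧
      LatticeExponents.upperExp₂ 1 Λ f = LatticeExponents.upperExp₁ 1 Λ f ∧
      LatticeExponents.upperExp₁ 1 Λ f ≤ 0) ∧
    (LatticeExponents.lowerExp₂ (d - 1) Λ f = -LatticeExponents.upperExp₁ d Λ f ∧
      LatticeExponents.upperExp₂ (d - 1) Λ f = -LatticeExponents.lowerExp₁ d Λ f) ∧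
    (LatticeExponents.lowerExp₂ d Λ f = 0 ∧ LatticeExponents.upperExp₂ d Λ f = 0) ∧
    (∀ k : ℕ, 1 ≤ k → k ≤ d - 1 →
      ((((k : ℝ) + 1) / k : ℝ) : EReal) * LatticeExponents.lowerExp₂ k Λ f
          ≤ LatticeExponents.lowerExp₂ (k + 1) Λ f ∧
      LatticeExponents.lowerExp₂ (k + 1) Λ f
          ≤ ((((d : ℝ) - k - 1) / ((d : ℝ) - k) : ℝ) : EReal)
              * LatticeExponents.lowerExp₂ k Λ f ∧
      ((((d : ℝ) - k - 1) / ((d : ℝ) - k) : ℝ) : EReal)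
          * LatticeExponents.lowerExp₂ k Λ f ≤ 0 ∧
      ((((k : ℝ) + 1) / k : ℝ) : EReal) * LatticeExponents.upperExp₂ k Λ f
          ≤ LatticeExponents.upperExp₂ (k + 1) Λ f ∧
      LatticeExponents.upperExp₂ (k + 1) Λ f
          ≤ ((((d : ℝ) - k - 1) / ((d : ℝ) - k) : ℝ) : EReal)
              * LatticeExponents.upperExp₂ k Λ f ∧
      ((((d : ℝ) - k - 1) / ((d : ℝ) - k) : ℝ) : EReal)
          * LatticeExponents.upperExp₂ k Λ f ≤ 0) ∧
    ((((d : ℝ) - 1 : ℝ) : EReal) * LatticeExponents.lowerExp₂ 1 Λ f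
          ≤ LatticeExponents.lowerExp₂ (d - 1) Λ f ∧
      LatticeExponents.lowerExp₂ (d - 1) Λ f
          ≤ LatticeExponents.lowerExp₂ 1 Λ f / (((d : ℝ) - 1 : ℝ) : EReal) ∧
      (((d : ℝ) - 1 : ℝ) : EReal) * LatticeExponents.upperExp₂ 1 Λ f
          ≤ LatticeExponents.upperExp₂ (d - 1) Λ f ∧
      LatticeExponents.upperExp₂ (d - 1) Λ f
          ≤ LatticeExponents.upperExp₂ 1 Λ f / (((d : ℝ) - 1 : ℝ) : EReal)) ∧
    (∀ k : ℕ, 1 ≤ k → k ≤ d →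
      LatticeExponents.lowerExp₁ k Λ f
          = -LatticeExponents.upperExp₁ (d + 1 - k) (LatticeExponents.dualLattice Λ)
              (LatticeExponents.reflect f) ∧
      LatticeExponents.upperExp₁ k Λ f
          = -LatticeExponents.lowerExp₁ (d + 1 - k) (LatticeExponents.dualLattice Λ)
              (LatticeExponents.reflect f)) ∧
    (∀ k : ℕ, 1 ≤ k → k ≤ d - 1 →
      LatticeExponents.lowerExp₂ k Λ f
          = LatticeExponents.lowerExp₂ (d - k) (LatticeExponents.dualLattice Λ)
              (LatticeExponents.reflect f) ∧
      LatticeExponents.upperExp₂ k Λ f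
          = LatticeExponents.upperExp₂ (d - k) (LatticeExponents.dualLattice Λ)
              (LatticeExponents.reflect f)) := by
  have hne := neBot_cobounded_traceZero hd
  obtain ⟨C, hC⟩ := exists_bound_logMinimum (by omega : 0 < d) Λ
  have hSd : ∀ τ, |sumLogMinimum d τ Λ| ≤ C := fun τ => (hC τ).1
  have hC0 : 0 ≤ C := (abs_nonneg _).trans (hSd 0)
  have hS1 : ∀ τ, sumLogMinimum 1 τ Λ = logMinimum 1 τ Λ := fun τ => by simp [sumLogMinimum]
  have hd' : (2 : ℝ) ≤ d := by exact_mod_cast hd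
  -- Zero is written as 0 / f so that the comparison lemmas for quotients by f apply to it.
  have hlo0 : liminf (fun τ => (((fun _ => 0 : traceZero d → ℝ) τ / f τ : ℝ) : EReal))
      (Bornology.cobounded _) = 0 := by simp
  have hup0 : limsup (fun τ => (((fun _ => 0 : traceZero d → ℝ) τ / f τ : ℝ) : EReal))
      (Bornology.cobounded _) = 0 := by simp
  have hlo_mul : ∀ {c : ℝ} (_ : 0 ≤ c) (k : ℕ), (c : EReal) * lowerExp₂ k Λ f =
      liminf (fun τ => ((c * sumLogMinimum k τ Λ / f τ : ℝ) : EReal)) (Bornology.cobounded _) := by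
    intro c hc k
    rw [lowerExp₂_eq, ← liminf_coe_const_mul hc]
    simp only [mul_div_assoc]
  have hup_mul : ∀ {c : ℝ} (_ : 0 ≤ c) (k : ℕ), (c : EReal) * upperExp₂ k Λ f =
      limsup (fun τ => ((c * sumLogMinimum k τ Λ / f τ : ℝ) : EReal)) (Bornology.cobounded _) := by
    intro c hc k
    rw [upperExp₂_eq, ← limsup_coe_const_mul hc]
    simp only [mul_div_assoc]
  have hpred : ∀ τ, |sumLogMinimum (d - 1) τ Λ + logMinimum d τ Λ| ≤ C := fun τ => by
    have h := sumLogMinimum_succ (d - 1) τ Λ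
    rw [Nat.sub_add_cancel (by omega)] at h
    rw [← h]
    exact hSd τ
  refine ⟨fun k hk hkd => ?_, ⟨?_, ?_, ?_, ?_⟩, ⟨?_, ?_⟩, ⟨?_, ?_⟩, fun k hk hkd => ?_,
    ⟨?_, ?_, ?_, ?_⟩, fun k hk hkd => ⟨?_, ?_⟩, fun k hk hkd => ⟨?_, ?_⟩⟩
  · have h : ∀ τ, logMinimum k τ Λ ≤ logMinimum (k + 1) τ Λ + 0 := fun τ => by
      rw [add_zero]
      exact logMinimum_mono τ Λ hk (by omega) (by omega)
    exact ⟨hf.liminf_div_le hd h, hf.limsup_div_le hd h⟩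
  · simp only [lowerExp₂_eq, hS1]
    rfl
  · rw [← hlo0]
    exact hf.liminf_div_le hd (C := C) fun τ => by
      rw [← hS1, zero_add]
      exact sumLogMinimum_le τ Λ (by omega) (hSd τ)
  · simp only [upperExp₂_eq, hS1]
    rfl
  · rw [← hup0]
    exact hf.limsup_div_le hd (C := C) fun τ => by
      rw [← hS1, zero_add]
      exact sumLogMinimum_le τ Λ (by omega) (hSd τ)
  · rw [lowerExp₂_eq]
    exact hf.liminf_div_eq_neg_limsup hd hpred
  · rw [upperExp₂_eq]
    exact hf.limsup_div_eq_neg_liminf hd hpred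
  · rw [lowerExp₂_eq, ← hlo0]
    exact hf.liminf_div_eq hd (C := C) fun τ => by simpa using hSd τ
  · rw [upperExp₂_eq, ← hup0]
    exact hf.limsup_div_eq hd (C := C) fun τ => by simpa using hSd τ
  · have hkd' : (k : ℝ) + 1 ≤ d := by exact_mod_cast (by omega : k + 1 ≤ d)
    -- The coefficient is 0 when k = d - 1; multiplication by it is still legitimate, as 0 times an
    -- infinite exponent is 0 in `EReal`.
    have hc : 0 ≤ ((d : ℝ) - k - 1) / ((d : ℝ) - k) :=
      div_nonneg (by linarith) (by linarith)
    have hc1 : ((d : ℝ) - k - 1) / ((d : ℝ) - k) ≤ 1 :=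
      div_le_one_of_le₀ (by linarith) (by linarith)
    have hc' : 0 ≤ ((k : ℝ) + 1) / k := by positivity
    have h1 : ∀ τ, ((k : ℝ) + 1) / k * sumLogMinimum k τ Λ ≤ sumLogMinimum (k + 1) τ Λ + 0 :=
      fun τ => by
        rw [add_zero]
        exact mul_sumLogMinimum_le_succ τ Λ hk (by omega)
    have h2 := fun τ => sumLogMinimum_succ_le τ Λ (k := k) (by omega) (hSd τ)
    have h3 : ∀ τ, ((d : ℝ) - k - 1) / ((d : ℝ) - k) * sumLogMinimum k τ Λ ≤ 0 + C := fun τ => by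
      have := sumLogMinimum_le τ Λ (k := k) (by omega) (hSd τ)
      rw [zero_add]
      exact (mul_le_mul_of_nonneg_left this hc).trans (mul_le_of_le_one_left hC0 hc1)
    rw [hlo_mul hc', hlo_mul hc, hup_mul hc', hup_mul hc, lowerExp₂_eq, upperExp₂_eq]
    refine ⟨hf.liminf_div_le hd h1, hf.liminf_div_le hd h2, ?_, hf.limsup_div_le hd h1,
      hf.limsup_div_le hd h2, ?_⟩
    · exact (hf.liminf_div_le hd h3).trans_eq hlo0
    · exact (hf.limsup_div_le hd h3).trans_eq hup0
  · rw [hlo_mul (by linarith), lowerExp₂_eq]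
    exact hf.liminf_div_le hd (C := 0) fun τ => by
      rw [hS1, add_zero]
      simpa [Nat.cast_sub (by omega : 1 ≤ d)] using
        mul_le_sumLogMinimum τ Λ (k := d - 1) (by omega)
  · rw [EReal.div_eq_inv_mul, ← EReal.coe_inv, hlo_mul (inv_nonneg.2 (by linarith)),
      lowerExp₂_eq]
    exact hf.liminf_div_le hd fun τ => sumLogMinimum_pred_le τ Λ hd (hSd τ)
  · rw [hup_mul (by linarith), upperExp₂_eq]
    exact hf.limsup_div_le hd (C := 0) fun τ => by
      rw [hS1, add_zero]
      simpa [Nat.cast_sub (by omega : 1 ≤ d)] using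
        mul_le_sumLogMinimum τ Λ (k := d - 1) (by omega)
  · rw [EReal.div_eq_inv_mul, ← EReal.coe_inv, hup_mul (inv_nonneg.2 (by linarith)),
      upperExp₂_eq]
    exact hf.limsup_div_le hd fun τ => sumLogMinimum_pred_le τ Λ hd (hSd τ)
  · simp only [lowerExp₁, upperExp₁, psi]
    -- The reflection turns the dual exponent for f* at τ into a quotient by f at -τ, where the
    -- uniform duality bound is stated.
    rw [limsup_reflect f fun τ => logMinimum (d + 1 - k) τ (dualLattice Λ)]
    exact hf.liminf_div_eq_neg_limsup hd fun τ => (hC τ).2.2 k hk hkd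
  · simp only [lowerExp₁, upperExp₁, psi]
    rw [liminf_reflect f fun τ => logMinimum (d + 1 - k) τ (dualLattice Λ)]
    exact hf.limsup_div_eq_neg_liminf hd fun τ => (hC τ).2.2 k hk hkd
  · rw [lowerExp₂_eq, lowerExp₂_eq,
      liminf_reflect f fun τ => sumLogMinimum (d - k) τ (dualLattice Λ)]
    exact hf.liminf_div_eq hd fun τ =>
      abs_sumLogMinimum_sub_dual_le (hC τ).2.1 (hC τ).2.2 (by omega)
  · rw [upperExp₂_eq, upperExp₂_eq,
      limsup_reflect f fun τ => sumLogMinimum (d - k) τ (dualLattice Λ)]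
    exact hf.limsup_div_eq hd fun τ =>
      abs_sumLogMinimum_sub_dual_le (hC τ).2.1 (hC τ).2.2 (by omega)
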